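/- Let $K$ be a field of characteristic zero with two commuting derivations $\partial_x,\partial_y$, let $K[D_x,D_y]$ be the ring of linear partial differential operators over $K$ (so $D_x\circ f=fD_x+f_x$, $D_y\circ f=fD_y+f_y$, $D_xD_y=D_yD_x$), and let $L=D_xD_y+aD_x+bD_y+c$ with $a,b,c\in K$. An operator $M\in K[D_x,D_y]$ generates a Darboux transformation of $L$ if there are $N,L_1\in K[D_x,D_y]$ with $N\circ L=L_1\circ M$, where $L_1$ has the same symbol (homogeneous part of top order) as $L$. For $\psi_1,\psi_2\in K$ put $$W_{1,1}(\psi,\psi_1,\psi_2)=\begin{vmatrix}\psi&\psi_x&\psi_y\\ \psi_1&\psi_{1,x}&\psi_{1,y}\\ \psi_2&\psi_{2,x}&\psi_{2,y}\end{vmatrix},$$ an operator of first order in $\psi$, whose coefficient of $D_x$ is $d=\psi_2\psi_{1,y}-\psi_1\psi_{2,y}$. The field $K$ is differentially closed if every finite system of differential polynomial equations together with an inequation, with coefficients in $K$, that has a solution in some differential field extension of $K$ has a solution in $K$. Theorem (completeness of the Darboux Wronskian formulas for bi-degree $(1,1)$). Let $K$ be differentially closed. 1. Let $M=D_x+qD_y+r$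 with $q,r\in K$, $q\neq0$ (the normalized case of total order two). If $M$ generates a Darboux transformation of $L$, then there are $\psi_1,\psi_2\in K$, linearly independent over the field of constants $\{k\in K: k_x=k_y=0\}$, with $L\psi_1=L\psi_2=0$, $d\neq0$ and $$M(\psi)=\frac1d\,W_{1,1}(\psi,\psi_1,\psi_2).$$ 2. More generally, let $M\in K[D_x,D_y]$ have bi-degree $(1,1)$ with respect to $L$, that is, modulo left multiples $A\circ L$ of $L$ it is an operator $m_{10}D_x+m_{01}D_y+m_{00}$ with $m_{10},m_{01}\neq0$. If $M$ generates a Darboux transformation of $L$, then $M=p\,M_0+A\circ L$ for some $0\neq p\in K$, some $A\in K[D_x,D_y]$ and some $M_0=\frac1dW_{1,1}(\cdot,\psi_1,\psi_2)$ as in 1. If $K$ is not assumed to be differentially closed, the conclusions of 1 and 2 hold over some differential field extension $F$ of $K$ (which may depend on $M$): there $\psi_1,\psi_2$, and also $p$ and $A$, have coefficients in $F$, and linear independence is over the constants of $F$. -/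

import Mathlib

universe u

noncomputable section

namespace DarbouxWronskian

open Finsupp

/-- A field with two commuting derivations `∂_x`, `∂_y`. -/
class PDiffField (K : Type u) [Field K] where
  dx : Derivation ℤ K K
  dy : Derivation ℤ K K
  dx_dy_comm : ∀ f : K, dx (dy f) = dy (dx f)

/-- The derivative `∂_x^i ∂_y^j f`. -/
def pderiv {K : Type u} [Field K] [PDiffField K] (i j : ℕ) (f : K) : K :=
  (fun g : K => PDiffField.dx g)^[i] ((fun g : K => PDiffField.dy g)^[j] f)

/-- The field of constants: the elements killed by both derivations. -/
def constants (K : Type u) [Field K] [PDiffField K] : Subfield K where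
  carrier := {c | PDiffField.dx c = 0 ∧ PDiffField.dy c = 0}
  zero_mem' := by simp
  one_mem' := by simp
  add_mem' := by
    rintro a b ⟨h1, h2⟩ ⟨h3, h4⟩
    simp [h1, h2, h3, h4]
  mul_mem' := by
    rintro a b ⟨h1, h2⟩ ⟨h3, h4⟩
    simp [h1, h2, h3, h4]
  neg_mem' := by
    rintro a ⟨h1, h2⟩
    simp [h1, h2]
  inv_mem' := by
    rintro a ⟨h1, h2⟩
    simp [Derivation.leibniz_inv, h1, h2]

/-- `F` is a differential field extension of `K`: the embedding `K → F` commutes with both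
derivations. -/
def IsDiffExtension (K F : Type u) [Field K] [PDiffField K] [Field F] [PDiffField F]
    [Algebra K F] : Prop :=
  ∀ f : K, algebraMap K F (PDiffField.dx f) = PDiffField.dx (algebraMap K F f) ∧
    algebraMap K F (PDiffField.dy f) = PDiffField.dy (algebraMap K F f)

/-- Differential polynomials over `K` in `n` differential indeterminates: the variable
`(k, i, j)` stands for `∂_x^i ∂_y^j u_k`. -/
abbrev DiffPoly (n : ℕ) (K : Type u) [Field K] := MvPolynomial (Fin n × ℕ × ℕ) K

/-- The value of a differential polynomial over `K` at a tuple of elements of `F`. -/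
def DiffPoly.evalAt {n : ℕ} {K F : Type u} [Field K] [Field F] [PDiffField F] [Algebra K F]
    (p : DiffPoly n K) (u : Fin n → F) : F :=
  MvPolynomial.aeval (fun v : Fin n × ℕ × ℕ => pderiv v.2.1 v.2.2 (u v.1)) p

/-- `K` is differentially closed: each finite system of differential polynomial equations
together with an inequation, with coefficients in `K`, which has a solution in some differential
field extension of `K` already has a solution in `K`. -/
def IsDifferentiallyClosed (K : Type u) [Field K] [PDiffField K] : Prop :=
  ∀ (F : Type u) [Field F] [PDiffField F] [Algebra K F], IsDiffExtension K F →
    ∀ (n : ℕ) (S : Finset (DiffPoly n K)) (g : DiffPoly n K),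
      (∃ u : Fin n → F, (∀ p ∈ S, p.evalAt u = 0) ∧ g.evalAt u ≠ 0) →
      ∃ u : Fin n → K, (∀ p ∈ S, p.evalAt u = 0) ∧ g.evalAt u ≠ 0

/-- Linear partial differential operators `∑ f_{ij} D_x^i D_y^j`, given by their finitely many
nonzero coefficients on the left of the derivatives; `f • P` is the operator `f ∘ P`. -/
abbrev LPDO (K : Type u) [Field K] := ℕ × ℕ →₀ K

section Operators

variable {K : Type u} [Field K] [PDiffField K]

/-- `D_x ∘ P`, from the rule `D_x ∘ f = f D_x + f_x`. -/
def dxComp (P : LPDO K) : LPDO K :=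
  P.sum fun p f => single (p.1 + 1, p.2) f + single p (PDiffField.dx f)

/-- `D_y ∘ P`, from the rule `D_y ∘ f = f D_y + f_y`. -/
def dyComp (P : LPDO K) : LPDO K :=
  P.sum fun p f => single (p.1, p.2 + 1) f + single p (PDiffField.dy f)

/-- The composition `N ∘ P` in `K[D_x, D_y]`. -/
def comp (N P : LPDO K) : LPDO K :=
  N.sum fun p f => f • dxComp^[p.1] (dyComp^[p.2] P)

/-- The result of applying an operator to a function. -/
def applyOp (P : LPDO K) (u : K) : K :=
  P.sum fun p f => f * pderiv p.1 p.2 u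

/-- The order of an operator (and `0` for the zero operator). -/
def order (P : LPDO K) : ℕ := P.support.sup fun p => p.1 + p.2

/-- The symbol of an operator: its homogeneous part of top order, as the family of coefficients
of the monomials `X^i Y^j`. -/
def symbol (P : LPDO K) : ℕ × ℕ →₀ K := P.filter fun p => p.1 + p.2 = order P

/-- `D_x D_y + a D_x + b D_y + c`. -/
def opL (a b c : K) : LPDO K :=
  single (1, 1) 1 + single (1, 0) a + single (0, 1) b + single (0, 0) c

/-- `D_x + q D_y + r`. -/
def opM (q r : K) : LPDO K :=
  single (1, 0) 1 + single (0, 1) q + single (0, 0) r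

/-- The Darboux transformation `N ∘ L = L₁ ∘ M`, where `L₁` has the same symbol as `L`. -/
def IsDarboux (L M N L₁ : LPDO K) : Prop :=
  symbol L₁ = symbol L ∧ comp N L = comp L₁ M

/-- `M` has bi-degree `(m, n)` with respect to `L`: modulo left multiples of `L` it is an operator
`M'` without mixed derivatives, in which `m` is the highest order in `D_x` and `n` the highest
order in `D_y`. -/
def HasBidegree (L M : LPDO K) (m n : ℕ) : Prop :=
  ∃ M' A : LPDO K, M = M' + comp A L ∧ (∀ p ∈ M'.support, p.1 = 0 ∨ p.2 = 0) ∧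
    M'.support.sup Prod.fst = m ∧ M'.support.sup Prod.snd = n

/-- The determinant with first row `(s, t, w)` and further rows `(ψ_i, ∂_x ψ_i, ∂_y ψ_i)`. -/
def wronskianDet (s t w ψ₁ ψ₂ : K) : K :=
  Matrix.det !![s, t, w;
    ψ₁, PDiffField.dx ψ₁, PDiffField.dy ψ₁;
    ψ₂, PDiffField.dx ψ₂, PDiffField.dy ψ₂]

/-- The operator `ψ ↦ W_{1,1}(ψ, ψ₁, ψ₂)`, by expansion of the determinant in its first row. -/
def wronskianOp (ψ₁ ψ₂ : K) : LPDO K :=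
  single (0, 0) (wronskianDet 1 0 0 ψ₁ ψ₂) + single (1, 0) (wronskianDet 0 1 0 ψ₁ ψ₂) +
    single (0, 1) (wronskianDet 0 0 1 ψ₁ ψ₂)

theorem applyOp_wronskianOp (ψ ψ₁ ψ₂ : K) :
    applyOp (wronskianOp ψ₁ ψ₂) ψ =
      wronskianDet ψ (PDiffField.dx ψ) (PDiffField.dy ψ) ψ₁ ψ₂ := by
  unfold applyOp wronskianOp
  rw [Finsupp.sum_add_index', Finsupp.sum_add_index', Finsupp.sum_single_index,
    Finsupp.sum_single_index, Finsupp.sum_single_index]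
  · simp [wronskianDet, Matrix.det_fin_three, pderiv]
    ring
  all_goals first | (rintro ⟨i, j⟩; intros; exact add_mul _ _ _) | (intros; simp)

/-- `M` is the operator given by the Darboux Wronskian formula for two solutions of `L u = 0`,
linearly independent over the constants, divided by its (nonzero) coefficient of `D_x`. -/
def IsNormalizedWronskian (L M : LPDO K) : Prop :=
  ∃ ψ₁ ψ₂ : K, applyOp L ψ₁ = 0 ∧ applyOp L ψ₂ = 0 ∧
    LinearIndependent (constants K) ![ψ₁, ψ₂] ∧
    wronskianDet 0 1 0 ψ₁ ψ₂ ≠ 0 ∧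
    M = (wronskianDet 0 1 0 ψ₁ ψ₂)⁻¹ • wronskianOp ψ₁ ψ₂

/-- `M` is given by the Darboux Wronskian formula up to left multiplication by a nonzero function
and addition of a left multiple of `L`. -/
def IsWronskianModulo (L M : LPDO K) : Prop :=
  ∃ (p : K) (A M₀ : LPDO K), p ≠ 0 ∧ IsNormalizedWronskian L M₀ ∧ M = p • M₀ + comp A L

end Operators

/-- Extension of scalars for operators. -/
def LPDO.baseChange {K : Type u} (F : Type u) [Field K] [Field F] [Algebra K F]
    (P : LPDO K) : LPDO F :=
  P.mapRange (algebraMap K F) (map_zero _)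

end DarbouxWronskian

end

open DarbouxWronskian

/-! Put `φ = ψ_y`. For `q ≠ 0` the equations `L ψ = M ψ = 0` become a first order linear system of
rank two for `(ψ, φ)`: `M ψ = 0` gives `ψ_x`, `L ψ = 0` gives `φ_x`, and equating the two
expressions for `ψ_xy` gives `φ_y`. Comparing coefficients in `N ∘ L = L₁ ∘ M` shows that this
system is integrable (`integrability_of_comp_eq`).

An integrable system has a fundamental matrix over an extension: adjoin its entries as
indeterminates and let the system define their derivatives (`exists_fundamental_matrix`). Its first
row consists of two common solutions `ψ₁, ψ₂` of `L` and `M`, and its determinant is `-d`, so `d ≠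
0`. By Cramer's rule a normalized `M` annihilating both is the Wronskian operator divided by `d`
(`isNormalizedWronskian_opM`). The conditions on `ψ₁, ψ₂` are a finite differential system with the
inequation `d ≠ 0`, so over a differentially closed field solutions exist in `K` itself. Bi-degree
`(1, 1)` reduces to the normalized case by `HasBidegree.exists_reduction`. -/

namespace DarbouxWronskian

open Finsupp

/-! ### Derivations of rational function fields -/

section Extension

variable {K F : Type u} {σ : Type*} [Field K] [Field F] [Algebra K F]
  [Algebra (MvPolynomial σ K) F] [IsScalarTower K (MvPolynomial σ K) F]
  [IsFractionRing (MvPolynomial σ K) F]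

/-- A derivation of `K` extends to the field of rational functions, with prescribed values on the
indeterminates. -/
theorem exists_derivation_of_isFractionRing_mvPolynomial (d : Derivation ℤ K K) (w : σ → F) :
    ∃ D : Derivation ℤ F F, (∀ k : K, D (algebraMap K F k) = algebraMap K F (d k)) ∧
      ∀ i, D (algebraMap (MvPolynomial σ K) F (MvPolynomial.X i)) = w i := by
  -- A derivation `D` is the same as a ring homomorphism `z ↦ z + D z ε` to the dual numbers lifting
  -- the identity. The extension is thus built from the universal properties of polynomial rings and
  -- of localizations.
  let ι : K →+* TrivSqZeroExt F F :=
    { toFun := fun k => TrivSqZeroExt.inl (algebraMap K F k) +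
        TrivSqZeroExt.inr (algebraMap K F (d k))
      map_one' := by ext <;> simp
      map_zero' := by ext <;> simp
      map_add' := fun x y => by ext <;> simp [Algebra.smul_def]
      map_mul' := fun x y => by
        ext <;> simp only [TrivSqZeroExt.fst_mul, TrivSqZeroExt.snd_mul, TrivSqZeroExt.fst_add,
          TrivSqZeroExt.snd_add, TrivSqZeroExt.fst_inl, TrivSqZeroExt.snd_inl,
          TrivSqZeroExt.fst_inr, TrivSqZeroExt.snd_inr, map_mul, map_add,
          Derivation.leibniz, op_smul_eq_smul, smul_eq_mul] <;> ring }
  let φ : MvPolynomial σ K →+* TrivSqZeroExt F F :=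
    MvPolynomial.eval₂Hom ι fun i =>
      TrivSqZeroExt.inl (algebraMap (MvPolynomial σ K) F (MvPolynomial.X i)) +
        TrivSqZeroExt.inr (w i)
  let π : TrivSqZeroExt F F →+* F :=
    { toFun := TrivSqZeroExt.fst
      map_one' := by simp
      map_zero' := by simp
      map_add' := fun x y => by simp
      map_mul' := fun x y => by simp }
  have hφC : ∀ k, φ (MvPolynomial.C k) = ι k := MvPolynomial.eval₂Hom_C _ _
  have hφX : ∀ i, φ (MvPolynomial.X i) =
      TrivSqZeroExt.inl (algebraMap (MvPolynomial σ K) F (MvPolynomial.X i)) +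
        TrivSqZeroExt.inr (w i) := MvPolynomial.eval₂Hom_X' _ _
  have hφ : π.comp φ = algebraMap (MvPolynomial σ K) F := by
    apply MvPolynomial.ringHom_ext
    · intro k
      rw [RingHom.comp_apply, hφC, ← MvPolynomial.algebraMap_eq,
        ← IsScalarTower.algebraMap_apply K (MvPolynomial σ K) F]
      change (ι k).fst = _
      simp [ι]
    · intro i
      rw [RingHom.comp_apply, hφX]
      change TrivSqZeroExt.fst _ = _
      simp
  -- A dual number is a unit as soon as its first component is, so `φ` extends to fractions.
  have hu : ∀ y : nonZeroDivisors (MvPolynomial σ K), IsUnit (φ y) := by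
    intro y
    rw [TrivSqZeroExt.isUnit_iff_isUnit_fst]
    have h : (φ y).fst = algebraMap (MvPolynomial σ K) F y := DFunLike.congr_fun hφ _
    rw [h]
    exact IsLocalization.map_units F y
  let Φ : F →+* TrivSqZeroExt F F := IsLocalization.lift hu
  -- The first component of `Φ` is the identity; this turns multiplicativity of `Φ` into the Leibniz
  -- rule for the second component.
  have hΦ : π.comp Φ = RingHom.id F := by
    apply IsLocalization.ringHom_ext (nonZeroDivisors (MvPolynomial σ K))
    rw [RingHom.comp_assoc, IsLocalization.lift_comp, hφ, RingHom.id_comp]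
  have hfst : ∀ z : F, (Φ z).fst = z := fun z => DFunLike.congr_fun hΦ z
  refine ⟨Derivation.mk' (AddMonoidHom.mk' (fun z => (Φ z).snd) fun x y => by
    simp).toIntLinearMap fun x y => ?_, fun k => ?_, fun i => ?_⟩
  · change (Φ (x * y)).snd = x * (Φ y).snd + y * (Φ x).snd
    rw [map_mul, TrivSqZeroExt.snd_mul, hfst, hfst, op_smul_eq_smul, smul_eq_mul, smul_eq_mul]
  · have h : Φ (algebraMap K F k) = ι k := by
      rw [IsScalarTower.algebraMap_apply K (MvPolynomial σ K) F, IsLocalization.lift_eq,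
        MvPolynomial.algebraMap_eq, hφC]
    change (Φ (algebraMap K F k)).snd = _
    rw [h]
    change (TrivSqZeroExt.inl _ + TrivSqZeroExt.inr _ : TrivSqZeroExt F F).snd = _
    rw [TrivSqZeroExt.snd_add, TrivSqZeroExt.snd_inl, TrivSqZeroExt.snd_inr, zero_add]
  · change (Φ _).snd = _
    rw [IsLocalization.lift_eq, hφX]
    simp

/-- Applied to a commutator, this reduces commutation of two derivations to a check on coefficients
and indeterminates. -/
theorem derivation_eq_zero_of_isFractionRing_mvPolynomial (D : Derivation ℤ F F)
    (hC : ∀ k : K, D (algebraMap K F k) = 0)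
    (hX : ∀ i, D (algebraMap (MvPolynomial σ K) F (MvPolynomial.X i)) = 0) : D = 0 := by
  have hpoly : ∀ p : MvPolynomial σ K, D (algebraMap _ _ p) = 0 := by
    intro p
    induction p using MvPolynomial.induction_on with
    | C k =>
      rw [← MvPolynomial.algebraMap_eq, ← IsScalarTower.algebraMap_apply K (MvPolynomial σ K) F]
      exact hC k
    | add p q hp hq => rw [map_add, map_add, hp, hq, add_zero]
    | mul_X p i hp => rw [map_mul, Derivation.leibniz, hp, hX i, smul_zero, smul_zero, add_zero]
  ext z
  obtain ⟨p, q, -, rfl⟩ := IsFractionRing.div_surjective (A := MvPolynomial σ K) z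
  simp [Derivation.leibniz_div, hpoly]

end Extension

/-! ### Integrable linear systems of rank two -/

section Linear

variable {K : Type u} [Field K] [PDiffField K]

local notation "∂x" => PDiffField.dx
local notation "∂y" => PDiffField.dy

/-- The indeterminates are the entries of a generic matrix `U`, with `U_x = A U` and `U_y = B U`
imposed. The hypothesis `hAB` is `A_y + A B = B_x + B A`, that is, equality of the two mixed
derivatives of `U`. -/
theorem exists_fundamental_matrix_of_isFractionRing (F : Type u) [Field F] [Algebra K F]
    [Algebra (MvPolynomial (Fin 2 × Fin 2) K) F]
    [IsScalarTower K (MvPolynomial (Fin 2 × Fin 2) K) F]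
    [IsFractionRing (MvPolynomial (Fin 2 × Fin 2) K) F] (A B : Fin 2 → Fin 2 → K)
    (hAB : ∀ i j, ∂y (A i j) + ∑ l, A i l * B l j = ∂x (B i j) + ∑ l, B i l * A l j) :
    ∃ _ : PDiffField F, IsDiffExtension K F ∧
      ∃ u : Fin 2 → Fin 2 → F,
        (∀ i k, ∂x (u i k) = ∑ j, algebraMap K F (A i j) * u j k) ∧
        (∀ i k, ∂y (u i k) = ∑ j, algebraMap K F (B i j) * u j k) ∧
        u 0 0 * u 1 1 - u 0 1 * u 1 0 ≠ 0 := by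
  let u : Fin 2 → Fin 2 → F := fun i k =>
    algebraMap (MvPolynomial (Fin 2 × Fin 2) K) F (MvPolynomial.X (i, k))
  obtain ⟨Dx, hxC, hxX⟩ := exists_derivation_of_isFractionRing_mvPolynomial
    (∂x : Derivation ℤ K K) (fun s : Fin 2 × Fin 2 => ∑ j, algebraMap K F (A s.1 j) * u j s.2)
  obtain ⟨Dy, hyC, hyX⟩ := exists_derivation_of_isFractionRing_mvPolynomial
    (∂y : Derivation ℤ K K) (fun s : Fin 2 × Fin 2 => ∑ j, algebraMap K F (B s.1 j) * u j s.2)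
  have hux : ∀ i k, Dx (u i k) = ∑ j, algebraMap K F (A i j) * u j k := fun i k => hxX (i, k)
  have huy : ∀ i k, Dy (u i k) = ∑ j, algebraMap K F (B i j) * u j k := fun i k => hyX (i, k)
  have hbr : ⁅Dx, Dy⁆ = 0 := by
    apply derivation_eq_zero_of_isFractionRing_mvPolynomial (K := K) (σ := Fin 2 × Fin 2)
    · intro k
      rw [Derivation.commutator_apply, hxC, hyC, hxC, hyC, PDiffField.dx_dy_comm, sub_self]
    · rintro ⟨i, k⟩
      rw [Derivation.commutator_apply]
      change Dx (Dy (u i k)) - Dy (Dx (u i k)) = 0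
      have h0 := congrArg (algebraMap K F) (hAB i 0)
      have h1 := congrArg (algebraMap K F) (hAB i 1)
      simp only [Fin.sum_univ_two, map_add, map_mul] at h0 h1
      rw [hux, huy]
      simp only [Fin.sum_univ_two, map_add, Derivation.leibniz, hux, huy, hxC, hyC, smul_eq_mul]
      linear_combination -h0 * u 0 k - h1 * u 1 k
  refine ⟨⟨Dx, Dy, fun f => ?_⟩, fun f => ⟨(hxC f).symm, (hyC f).symm⟩, u, hux, huy, ?_⟩
  · have h := DFunLike.congr_fun hbr f
    rw [Derivation.commutator_apply] at h
    exact sub_eq_zero.mp h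
  · simp only [u, ← map_mul, ← map_sub]
    rw [Ne, FaithfulSMul.algebraMap_eq_zero_iff (MvPolynomial (Fin 2 × Fin 2) K) F]
    intro h
    -- The generic determinant is not the zero polynomial: its value at the identity matrix is `1`.
    have h' := congrArg
      (MvPolynomial.eval fun s : Fin 2 × Fin 2 => if s.1 = s.2 then (1 : K) else 0) h
    simp at h'

/-- An integrable linear differential system of rank two has a fundamental matrix over some
differential field extension. -/
theorem exists_fundamental_matrix (A B : Fin 2 → Fin 2 → K)
    (hAB : ∀ i j, ∂y (A i j) + ∑ l, A i l * B l j = ∂x (B i j) + ∑ l, B i l * A l j) :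
    ∃ (F : Type u) (_ : Field F) (_ : PDiffField F) (_ : Algebra K F), IsDiffExtension K F ∧
      ∃ u : Fin 2 → Fin 2 → F,
        (∀ i k, ∂x (u i k) = ∑ j, algebraMap K F (A i j) * u j k) ∧
        (∀ i k, ∂y (u i k) = ∑ j, algebraMap K F (B i j) * u j k) ∧
        u 0 0 * u 1 1 - u 0 1 * u 1 0 ≠ 0 := by
  obtain ⟨i, h⟩ := exists_fundamental_matrix_of_isFractionRing
    (FractionRing (MvPolynomial (Fin 2 × Fin 2) K)) A B hAB
  exact ⟨_, inferInstance, i, inferInstance, h⟩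

end Linear

/-! ### The ring structure of differential operators, coefficientwise -/

section Composition

variable {K : Type u} [Field K] [PDiffField K]

local notation "∂x" => PDiffField.dx
local notation "∂y" => PDiffField.dy

theorem dxComp_zero : dxComp (0 : LPDO K) = 0 := Finsupp.sum_zero_index

theorem dyComp_zero : dyComp (0 : LPDO K) = 0 := Finsupp.sum_zero_index

theorem dxComp_single (p : ℕ × ℕ) (f : K) :
    dxComp (single p f) = single (p.1 + 1, p.2) f + single p (∂x f) :=
  Finsupp.sum_single_index (by simp)

theorem dyComp_single (p : ℕ × ℕ) (f : K) :
    dyComp (single p f) = single (p.1, p.2 + 1) f + single p (∂y f) :=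
  Finsupp.sum_single_index (by simp)

theorem dxComp_add (P Q : LPDO K) : dxComp (P + Q) = dxComp P + dxComp Q :=
  Finsupp.sum_add_index' (by simp) fun p f g => by
    rw [map_add, single_add, single_add]; abel

theorem dyComp_add (P Q : LPDO K) : dyComp (P + Q) = dyComp P + dyComp Q :=
  Finsupp.sum_add_index' (by simp) fun p f g => by
    rw [map_add, single_add, single_add]; abel

theorem dxComp_smul (f : K) (P : LPDO K) : dxComp (f • P) = f • dxComp P + ∂x f • P := by
  induction P using Finsupp.induction_linear with
  | zero => simp [dxComp_zero]
  | add P Q hP hQ => rw [smul_add, dxComp_add, hP, hQ, dxComp_add, smul_add, smul_add]; abel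
  | single p g =>
    simp only [smul_single, dxComp_single, smul_eq_mul, smul_add, Derivation.leibniz, single_add,
      mul_comm g]
    abel

theorem dyComp_smul (f : K) (P : LPDO K) : dyComp (f • P) = f • dyComp P + ∂y f • P := by
  induction P using Finsupp.induction_linear with
  | zero => simp [dyComp_zero]
  | add P Q hP hQ => rw [smul_add, dyComp_add, hP, hQ, dyComp_add, smul_add, smul_add]; abel
  | single p g =>
    simp only [smul_single, dyComp_single, smul_eq_mul, smul_add, Derivation.leibniz, single_add,
      mul_comm g]
    abel

theorem dyComp_dxComp (P : LPDO K) : dyComp (dxComp P) = dxComp (dyComp P) := by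
  induction P using Finsupp.induction_linear with
  | zero => simp [dxComp_zero, dyComp_zero]
  | add P Q hP hQ => rw [dxComp_add, dyComp_add, dyComp_add, dxComp_add, hP, hQ]
  | single p g =>
    simp only [dxComp_single, dyComp_single, dxComp_add, dyComp_add, PDiffField.dx_dy_comm]
    abel

theorem dxComp_apply_zero (P : LPDO K) (l : ℕ) : dxComp P (0, l) = ∂x (P (0, l)) := by
  induction P using Finsupp.induction_linear with
  | zero => simp [dxComp_zero]
  | add P Q hP hQ => rw [dxComp_add, Finsupp.add_apply, hP, hQ, Finsupp.add_apply, map_add]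
  | single p g =>
    rw [dxComp_single, Finsupp.add_apply, single_eq_of_ne (by simp), zero_add, single_apply,
      single_apply]
    split_ifs <;> simp

theorem dxComp_apply_succ (P : LPDO K) (k l : ℕ) :
    dxComp P (k + 1, l) = P (k, l) + ∂x (P (k + 1, l)) := by
  induction P using Finsupp.induction_linear with
  | zero => simp [dxComp_zero]
  | add P Q hP hQ =>
    rw [dxComp_add, Finsupp.add_apply, hP, hQ, Finsupp.add_apply, Finsupp.add_apply, map_add]; ring
  | single p g =>
    rw [dxComp_single, Finsupp.add_apply]
    congr 1
    · simp [single_apply, Prod.ext_iff]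
    · simp only [single_apply]
      split_ifs <;> simp

theorem dyComp_apply_zero (P : LPDO K) (k : ℕ) : dyComp P (k, 0) = ∂y (P (k, 0)) := by
  induction P using Finsupp.induction_linear with
  | zero => simp [dyComp_zero]
  | add P Q hP hQ => rw [dyComp_add, Finsupp.add_apply, hP, hQ, Finsupp.add_apply, map_add]
  | single p g =>
    rw [dyComp_single, Finsupp.add_apply, single_eq_of_ne (by simp), zero_add, single_apply,
      single_apply]
    split_ifs <;> simp

theorem dyComp_apply_succ (P : LPDO K) (k l : ℕ) :
    dyComp P (k, l + 1) = P (k, l) + ∂y (P (k, l + 1)) := by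
  induction P using Finsupp.induction_linear with
  | zero => simp [dyComp_zero]
  | add P Q hP hQ =>
    rw [dyComp_add, Finsupp.add_apply, hP, hQ, Finsupp.add_apply, Finsupp.add_apply, map_add]; ring
  | single p g =>
    rw [dyComp_single, Finsupp.add_apply]
    congr 1
    · simp [single_apply, Prod.ext_iff]
    · simp only [single_apply]
      split_ifs <;> simp

theorem dxComp_iterate_add (n : ℕ) (P Q : LPDO K) :
    dxComp^[n] (P + Q) = dxComp^[n] P + dxComp^[n] Q := by
  induction n with
  | zero => rfl
  | succ n ih => simp only [Function.iterate_succ_apply', ih, dxComp_add]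

theorem dyComp_iterate_add (n : ℕ) (P Q : LPDO K) :
    dyComp^[n] (P + Q) = dyComp^[n] P + dyComp^[n] Q := by
  induction n with
  | zero => rfl
  | succ n ih => simp only [Function.iterate_succ_apply', ih, dyComp_add]

theorem comp_single_left (p : ℕ × ℕ) (f : K) (P : LPDO K) :
    comp (single p f) P = f • dxComp^[p.1] (dyComp^[p.2] P) :=
  Finsupp.sum_single_index (zero_smul _ _)

theorem comp_zero_left (P : LPDO K) : comp 0 P = 0 := Finsupp.sum_zero_index

theorem comp_add_left (N N' P : LPDO K) : comp (N + N') P = comp N P + comp N' P :=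
  Finsupp.sum_add_index' (fun _ => zero_smul _ _) fun _ _ _ => add_smul _ _ _

theorem comp_add_right (N P Q : LPDO K) : comp N (P + Q) = comp N P + comp N Q := by
  simp only [comp, dxComp_iterate_add, dyComp_iterate_add, smul_add, Finsupp.sum_add]

theorem comp_smul_left (f : K) (N P : LPDO K) : comp (f • N) P = f • comp N P := by
  induction N using Finsupp.induction_linear with
  | zero => simp [comp_zero_left]
  | add N N' h h' => rw [smul_add, comp_add_left, h, h', comp_add_left, smul_add]
  | single p g => rw [smul_single, comp_single_left, comp_single_left, smul_smul, smul_eq_mul]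

theorem comp_dxComp (N P : LPDO K) : comp (dxComp N) P = dxComp (comp N P) := by
  induction N using Finsupp.induction_linear with
  | zero => simp [comp_zero_left, dxComp_zero]
  | add N N' h h' => rw [dxComp_add, comp_add_left, h, h', comp_add_left, dxComp_add]
  | single p g =>
    simp only [dxComp_single, comp_add_left, comp_single_left, dxComp_smul,
      Function.iterate_succ_apply']

theorem comp_dyComp (N P : LPDO K) : comp (dyComp N) P = dyComp (comp N P) := by
  induction N using Finsupp.induction_linear with
  | zero => simp [comp_zero_left, dyComp_zero]
  | add N N' h h' => rw [dyComp_add, comp_add_left, h, h', comp_add_left, dyComp_add]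
  | single p g =>
    have hcomm : Function.Commute (dyComp (K := K)) dxComp := dyComp_dxComp
    simp only [dyComp_single, comp_add_left, comp_single_left, dyComp_smul,
      Function.iterate_succ_apply']
    rw [← (hcomm.iterate_right p.1).eq]

/-- Composition on the right with `Q` commutes with the left actions of functions, `D_x` and `D_y`,
and these generate all operators. -/
theorem comp_assoc (N P Q : LPDO K) : comp (comp N P) Q = comp N (comp P Q) := by
  induction N using Finsupp.induction_linear with
  | zero => simp only [comp_zero_left]
  | add N N' h h' => simp only [comp_add_left, h, h']
  | single p g =>
    rw [comp_single_left, comp_single_left, comp_smul_left]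
    congr 1
    have hy : ∀ n, comp (dyComp^[n] P) Q = dyComp^[n] (comp P Q) := by
      intro n
      induction n with
      | zero => rfl
      | succ n ih =>
        rw [Function.iterate_succ_apply', comp_dyComp, ih, Function.iterate_succ_apply']
    rw [← hy]
    generalize dyComp^[p.2] P = R
    induction p.1 with
    | zero => rfl
    | succ n ih => rw [Function.iterate_succ_apply', comp_dxComp, ih, Function.iterate_succ_apply']

theorem comp_single_zero_left (f : K) (P : LPDO K) : comp (single (0, 0) f) P = f • P :=
  comp_single_left _ _ _

end Composition

/-! ### Extension of scalars is compatible with composition -/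

section BaseChange

variable {K F : Type u} [Field K] [Field F] [Algebra K F]

theorem baseChange_single (p : ℕ × ℕ) (f : K) :
    LPDO.baseChange F (single p f) = single p (algebraMap K F f) := Finsupp.mapRange_single

theorem baseChange_add (P Q : LPDO K) :
    (P + Q).baseChange F = P.baseChange F + Q.baseChange F :=
  Finsupp.mapRange_add (map_add _) P Q

theorem baseChange_zero : (0 : LPDO K).baseChange F = 0 := Finsupp.mapRange_zero

theorem baseChange_smul (f : K) (P : LPDO K) :
    (f • P).baseChange F = algebraMap K F f • P.baseChange F := by
  ext p
  simp [LPDO.baseChange, Algebra.smul_def]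

theorem baseChange_opL (a b c : K) :
    (opL a b c).baseChange F = opL (algebraMap K F a) (algebraMap K F b) (algebraMap K F c) := by
  simp only [opL, baseChange_add, baseChange_single, map_one]

theorem baseChange_opM (q r : K) :
    (opM q r).baseChange F = opM (algebraMap K F q) (algebraMap K F r) := by
  simp only [opM, baseChange_add, baseChange_single, map_one]

variable [PDiffField K] [PDiffField F]

theorem baseChange_dxComp (h : IsDiffExtension K F) (P : LPDO K) :
    (dxComp P).baseChange F = dxComp (P.baseChange F) := by
  induction P using Finsupp.induction_linear with
  | zero => simp only [dxComp_zero, baseChange_zero]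
  | add P Q hP hQ => simp only [dxComp_add, baseChange_add, hP, hQ]
  | single p f => simp only [dxComp_single, baseChange_add, baseChange_single, (h f).1]

theorem baseChange_dyComp (h : IsDiffExtension K F) (P : LPDO K) :
    (dyComp P).baseChange F = dyComp (P.baseChange F) := by
  induction P using Finsupp.induction_linear with
  | zero => simp only [dyComp_zero, baseChange_zero]
  | add P Q hP hQ => simp only [dyComp_add, baseChange_add, hP, hQ]
  | single p f => simp only [dyComp_single, baseChange_add, baseChange_single, (h f).2]

theorem baseChange_comp (h : IsDiffExtension K F) (N P : LPDO K) :
    (comp N P).baseChange F = comp (N.baseChange F) (P.baseChange F) := by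
  induction N using Finsupp.induction_linear with
  | zero => simp only [comp_zero_left, baseChange_zero]
  | add N N' hN hN' => simp only [comp_add_left, baseChange_add, hN, hN']
  | single p f =>
    have hx : Function.Semiconj (LPDO.baseChange (K := K) F) dxComp dxComp := baseChange_dxComp h
    have hy : Function.Semiconj (LPDO.baseChange (K := K) F) dyComp dyComp := baseChange_dyComp h
    rw [comp_single_left, baseChange_smul, baseChange_single, comp_single_left,
      (hx.iterate_right p.1).eq, (hy.iterate_right p.2).eq]

end BaseChange

/-! ### Normal forms, compatibility conditions and the Wronskian operator -/

section Operators

variable {K : Type u} [Field K]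

theorem opL_apply_eq_zero (a b c : K) {k l : ℕ} (h : 3 ≤ k + l) : opL a b c (k, l) = 0 := by
  simp only [opL, Finsupp.add_apply, single_apply, Prod.mk.injEq]
  rw [if_neg (by omega), if_neg (by omega), if_neg (by omega), if_neg (by omega)]
  simp

theorem opM_apply_eq_zero (q r : K) {k l : ℕ} (h : 2 ≤ k + l) : opM q r (k, l) = 0 := by
  simp only [opM, Finsupp.add_apply, single_apply, Prod.mk.injEq]
  rw [if_neg (by omega), if_neg (by omega), if_neg (by omega)]
  simp

theorem order_opL (a b c : K) : order (opL a b c) = 2 := by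
  apply le_antisymm
  · apply Finset.sup_le
    rintro ⟨k, l⟩ hp
    by_contra h
    exact (mem_support_iff.mp hp) (opL_apply_eq_zero a b c (by omega))
  · exact Finset.le_sup (f := fun p : ℕ × ℕ => p.1 + p.2) (b := (1, 1))
      (mem_support_iff.mpr (by simp [opL]))

theorem exists_eq_opL_of_symbol_eq {a b c : K} {P : LPDO K}
    (h : symbol P = symbol (opL a b c)) : ∃ a₁ b₁ c₁ : K, P = opL a₁ b₁ c₁ := by
  have hsym : ∀ p : ℕ × ℕ, (if p.1 + p.2 = order P then P p else 0) =
      if p.1 + p.2 = 2 then opL a b c p else 0 := by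
    intro p
    have := DFunLike.congr_fun h p
    rwa [symbol, symbol, filter_apply, filter_apply, order_opL] at this
  -- The symbol is cut out by the order, so the order is needed first: if it were not `2`, the
  -- symbol of `P` would lack the monomial `X Y`.
  have hord : order P = 2 := by
    have := hsym (1, 1)
    by_contra hne
    have hne' : ¬ ((1, 1) : ℕ × ℕ).1 + ((1, 1) : ℕ × ℕ).2 = order P := Ne.symm hne
    rw [if_neg hne'] at this
    simp [opL] at this
  refine ⟨P (1, 0), P (0, 1), P (0, 0), ?_⟩
  ext ⟨k, l⟩
  rcases lt_trichotomy (k + l) 2 with hlt | heq | hgt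
  · obtain ⟨rfl, rfl⟩ | ⟨rfl, rfl⟩ | ⟨rfl, rfl⟩ :
      (k = 0 ∧ l = 0) ∨ (k = 1 ∧ l = 0) ∨ (k = 0 ∧ l = 1) := by omega
    all_goals simp [opL]
  · have := hsym (k, l)
    rw [hord, if_pos heq, if_pos heq] at this
    rw [this]
    obtain ⟨rfl, rfl⟩ | ⟨rfl, rfl⟩ | ⟨rfl, rfl⟩ :
      (k = 0 ∧ l = 2) ∨ (k = 1 ∧ l = 1) ∨ (k = 2 ∧ l = 0) := by omega
    all_goals simp [opL]
  · rw [opL_apply_eq_zero _ _ _ hgt]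
    by_contra hne
    have : k + l ≤ order P := Finset.le_sup (f := fun p : ℕ × ℕ => p.1 + p.2)
      (mem_support_iff.mpr hne)
    omega

theorem exists_eq_smul_opM {P : LPDO K} (hP : ∀ p ∈ P.support, p.1 = 0 ∨ p.2 = 0)
    (hx : P.support.sup Prod.fst = 1) (hy : P.support.sup Prod.snd = 1) :
    ∃ p q r : K, p ≠ 0 ∧ q ≠ 0 ∧ P = p • opM q r := by
  -- The supremum over an empty support is `0`, so the value `1` is attained at some monomial;
  -- having no mixed derivative, it can only be `D_x`.
  have hx' : P (1, 0) ≠ 0 := by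
    obtain ⟨⟨k, l⟩, hs, hk⟩ := Finset.exists_mem_eq_sup P.support
      (Finset.nonempty_iff_ne_empty.mpr fun h => by simp [h] at hx) Prod.fst
    rw [hx] at hk
    have := hP _ hs
    obtain rfl : k = 1 := hk.symm
    obtain rfl : l = 0 := by simpa using this
    exact mem_support_iff.mp hs
  have hy' : P (0, 1) ≠ 0 := by
    obtain ⟨⟨k, l⟩, hs, hl⟩ := Finset.exists_mem_eq_sup P.support
      (Finset.nonempty_iff_ne_empty.mpr fun h => by simp [h] at hx) Prod.snd
    rw [hy] at hl
    have := hP _ hs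
    obtain rfl : l = 1 := hl.symm
    obtain rfl : k = 0 := by simpa using this
    exact mem_support_iff.mp hs
  refine ⟨P (1, 0), P (0, 1) / P (1, 0), P (0, 0) / P (1, 0), hx', div_ne_zero hy' hx', ?_⟩
  ext ⟨k, l⟩
  rw [Finsupp.smul_apply, smul_eq_mul]
  rcases lt_or_ge (k + l) 2 with hlt | hge
  · obtain ⟨rfl, rfl⟩ | ⟨rfl, rfl⟩ | ⟨rfl, rfl⟩ :
      (k = 0 ∧ l = 0) ∨ (k = 1 ∧ l = 0) ∨ (k = 0 ∧ l = 1) := by omega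
    all_goals simp [opM, mul_div_cancel₀ _ hx']
  · rw [opM_apply_eq_zero _ _ hge, mul_zero]
    by_contra hne
    have hs := mem_support_iff.mpr hne
    have h1 : k ≤ 1 := hx ▸ Finset.le_sup (f := Prod.fst) hs
    have h2 : l ≤ 1 := hy ▸ Finset.le_sup (f := Prod.snd) hs
    have h3 : k = 0 ∨ l = 0 := hP _ hs
    omega

variable [PDiffField K]

local notation "∂x" => PDiffField.dx
local notation "∂y" => PDiffField.dy

theorem comp_opL (a b c : K) (P : LPDO K) :
    comp (opL a b c) P = dxComp (dyComp P) + a • dxComp P + b • dyComp P + c • P := by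
  simp only [opL, comp_add_left, comp_single_left, Function.iterate_one, Function.iterate_zero,
    id_eq, one_smul]

/-- A gauge transformation: conjugation by a nonzero function changes only the lower coefficients.
It moves the factor `p` of a non-normalized `M` to the left of `L₁`. -/
theorem comp_opL_single (a b c : K) {p : K} (hp : p ≠ 0) :
    ∃ a' b' c' : K, comp (opL a b c) (single (0, 0) p) = p • opL a' b' c' := by
  refine ⟨p⁻¹ * (∂y p + a * p), p⁻¹ * (∂x p + b * p),
    p⁻¹ * (∂x (∂y p) + a * ∂x p + b * ∂y p + c * p), ?_⟩
  rw [comp_opL]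
  simp only [dxComp_single, dyComp_single, dxComp_add, opL, smul_add, smul_single,
    smul_eq_mul, mul_inv_cancel_left₀ hp, mul_one, single_add, zero_add]
  abel

/-- The leading term of `D_x^i D_y^j ∘ L` is `D_x^(i+1) D_y^(j+1)`; the lower coefficients of `L`
and their derivatives only enter in degrees below `i + j + 2`. -/
theorem iterate_comp_opL_apply (a b c : K) (i j k l : ℕ) (h : i + j + 2 ≤ k + l) :
    dxComp^[i] (dyComp^[j] (opL a b c)) (k, l) = if (i + 1, j + 1) = (k, l) then 1 else 0 := by
  induction i generalizing k with
  | zero =>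
    induction j generalizing l with
    | zero =>
      rcases h.eq_or_lt with h | h
      · obtain ⟨rfl, rfl⟩ | ⟨rfl, rfl⟩ | ⟨rfl, rfl⟩ :
          (k = 0 ∧ l = 2) ∨ (k = 1 ∧ l = 1) ∨ (k = 2 ∧ l = 0) := by omega
        all_goals simp [opL]
      · rw [if_neg (by simp; omega)]
        exact opL_apply_eq_zero a b c (by omega)
    | succ j ih =>
      simp only [Function.iterate_zero, id_eq] at ih ⊢
      rw [Function.iterate_succ_apply']
      cases l with
      | zero =>
        rw [dyComp_apply_zero, ih _ (by omega), if_neg (by simp), if_neg (by simp), map_zero]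
      | succ l =>
        rw [dyComp_apply_succ, ih _ (by omega), ih _ (by omega), if_neg (c := _ = (k, l + 1)),
          map_zero, add_zero]
        · simp
        · simp only [Prod.mk.injEq]; omega
  | succ i ih =>
    rw [Function.iterate_succ_apply']
    cases k with
    | zero =>
      rw [dxComp_apply_zero, ih _ (by omega), if_neg (by simp), if_neg (by simp), map_zero]
    | succ k =>
      rw [dxComp_apply_succ, ih _ (by omega), ih _ (by omega), if_neg (c := _ = (k + 1, l)),
        map_zero, add_zero]
      · simp
      · simp only [Prod.mk.injEq]; omega

theorem comp_opL_apply_of_forall_degree_le (a b c : K) {N : LPDO K} {i j : ℕ}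
    (h : ∀ p ∈ N.support, p.1 + p.2 ≤ i + j) : comp N (opL a b c) (i + 1, j + 1) = N (i, j) := by
  rw [comp, Finsupp.sum_apply, Finsupp.sum]
  rw [Finset.sum_congr rfl (g := fun p => if p = (i, j) then N p else 0)]
  · rw [Finset.sum_ite_eq']
    split_ifs with hs
    · rfl
    · exact (notMem_support_iff.mp hs).symm
  · rintro ⟨k, l⟩ hp
    rw [Finsupp.smul_apply, iterate_comp_opL_apply a b c k l (i + 1) (j + 1)
      (by have := h _ hp; simp only at this; omega)]
    simp

/-- Symbols multiply: `L₁ ∘ M` has order at most three and `L` has order two, so `N` has order at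
most one. -/
theorem exists_eq_of_comp_opL_eq {a b c a₁ b₁ c₁ q r : K} {N : LPDO K}
    (h : comp N (opL a b c) = comp (opL a₁ b₁ c₁) (opM q r)) :
    ∃ n₁ n₂ n₀ : K, N = single (1, 0) n₁ + single (0, 1) n₂ + single (0, 0) n₀ := by
  have hdeg : ∀ p ∈ N.support, p.1 + p.2 ≤ 1 := by
    by_contra! hcon
    obtain ⟨p₀, hp₀, hlt⟩ := hcon
    obtain ⟨⟨i, j⟩, hs, hmax⟩ := Finset.exists_max_image N.support (fun p => p.1 + p.2) ⟨p₀, hp₀⟩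
    have h2 : 2 ≤ i + j := hlt.trans_le (hmax _ hp₀)
    apply mem_support_iff.mp hs
    rw [← comp_opL_apply_of_forall_degree_le a b c hmax, h, comp_opL]
    simp (disch := omega) only [Finsupp.add_apply, Finsupp.smul_apply, dxComp_apply_succ,
      dyComp_apply_succ, opM_apply_eq_zero, map_zero, smul_zero, add_zero]
  refine ⟨N (1, 0), N (0, 1), N (0, 0), ?_⟩
  ext ⟨k, l⟩
  rcases lt_or_ge (k + l) 2 with hlt | hge
  · obtain ⟨rfl, rfl⟩ | ⟨rfl, rfl⟩ | ⟨rfl, rfl⟩ :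
      (k = 0 ∧ l = 0) ∨ (k = 1 ∧ l = 0) ∨ (k = 0 ∧ l = 1) := by omega
    all_goals simp
  · have h0 : N (k, l) = 0 := by
      by_contra hne
      have := hdeg _ (mem_support_iff.mpr hne)
      simp only at this
      omega
    simp only [h0, Finsupp.add_apply, single_apply, Prod.mk.injEq]
    rw [if_neg (by omega), if_neg (by omega), if_neg (by omega)]
    simp

/-- The compatibility conditions of the system `ψ_x = -r ψ - q φ`, `ψ_y = φ`,
`φ_x = (a r - c) ψ + (a q - b) φ`, `φ_y = g ψ + h φ`, which is equivalent to `L ψ = M ψ = 0`. -/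
theorem integrability_of_comp_eq {a b c a₁ b₁ c₁ q r g h : K} {N : LPDO K} (hq : q ≠ 0)
    (hN : comp N (opL a b c) = comp (opL a₁ b₁ c₁) (opM q r))
    (hg : q * g = -(∂y r + (a * r - c))) (hh : q * h = -(∂y q + r + (a * q - b))) :
    ∂y (a * r - c) + (a * q - b) * g = ∂x g - g * r + h * (a * r - c) ∧
      a * r - c + ∂y (a * q - b) = ∂x h - g * q := by
  obtain ⟨n₁, n₂, n₀, rfl⟩ := exists_eq_of_comp_opL_eq hN
  -- The logarithmic derivative `q_x / q`, named to keep division out of the polynomial identities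
  -- below.
  obtain ⟨k, hk⟩ : ∃ k, ∂x q = q * k := ⟨∂x q / q, (mul_div_cancel₀ _ hq).symm⟩
  simp only [comp_opL, comp_add_left, comp_single_left, Function.iterate_one,
    Function.iterate_zero, id_eq] at hN
  have e := fun i j => DFunLike.congr_fun hN (i, j)
  -- The cubic coefficients give `n₁ = 1` and `n₂ = q`; the quadratic ones give `a₁`, `b₁`, `n₀`,
  -- and that of `D_x` gives `c₁`. The two left over, at `D_y` and `1`, carry the compatibility
  -- conditions.
  have e21 := e 2 1
  have e12 := e 1 2
  have e20 := e 2 0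
  have e11 := e 1 1
  have e02 := e 0 2
  have e10 := e 1 0
  have e01 := e 0 1
  have e00 := e 0 0
  clear e
  simp [dxComp_apply_succ, dxComp_apply_zero, dyComp_apply_succ, dyComp_apply_zero, opL,
    opM] at e21 e12 e20 e11 e02 e10 e01 e00
  subst e21 e12
  obtain rfl : a₁ = a := by rw [← e20, one_mul]
  obtain rfl : b₁ = b - k := mul_left_cancel₀ hq (by linear_combination -e02 - hk)
  obtain rfl : n₀ = r + ∂y n₂ - k := by linear_combination e11
  obtain rfl : c₁ = c + ∂x a₁ + n₂ * ∂y a₁ + (r + ∂y n₂ - k) * a₁ - ∂y r - a₁ * r := by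
    linear_combination -e10
  -- Only `q g` and `q h` are given, so `g_x` and `h_x` are reached by differentiating these
  -- products, and the goals are multiplied by `q`.
  have hgx := congrArg (fun z => ∂x z) hg
  have hhx := congrArg (fun z => ∂x z) hh
  simp only [map_add, map_sub, map_neg, Derivation.leibniz, smul_eq_mul, hk] at hgx hhx e01 ⊢
  constructor <;> apply mul_left_cancel₀ hq
  · linear_combination -e00 - hgx + k * hg + (a₁ * n₂ - b + r) * hg - (a₁ * r - c) * hh
  · linear_combination -e01 - hhx + k * hh + n₂ * hg

theorem applyOp_opL (a b c ψ : K) :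
    applyOp (opL a b c) ψ = ∂x (∂y ψ) + a * ∂x ψ + b * ∂y ψ + c * ψ := by
  unfold applyOp opL
  rw [Finsupp.sum_add_index', Finsupp.sum_add_index', Finsupp.sum_add_index',
    Finsupp.sum_single_index, Finsupp.sum_single_index, Finsupp.sum_single_index,
    Finsupp.sum_single_index]
  · simp [pderiv]
  all_goals first | (rintro ⟨i, j⟩; intros; exact add_mul _ _ _) | (intros; simp)

theorem wronskianDet_zero_one_zero (ψ₁ ψ₂ : K) :
    wronskianDet 0 1 0 ψ₁ ψ₂ = ψ₂ * ∂y ψ₁ - ψ₁ * ∂y ψ₂ := by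
  simp [wronskianDet, Matrix.det_fin_three]
  ring

/-- A constant relation and its `y`-derivative form a homogeneous linear system for the two
constants, with determinant `±d`. -/
theorem linearIndependent_of_wronskianDet_ne_zero {ψ₁ ψ₂ : K}
    (h : wronskianDet 0 1 0 ψ₁ ψ₂ ≠ 0) : LinearIndependent (constants K) ![ψ₁, ψ₂] := by
  rw [wronskianDet_zero_one_zero] at h
  rw [LinearIndependent.pair_iff]
  rintro ⟨s, _, hs⟩ ⟨t, _, ht⟩ hst
  change s * ψ₁ + t * ψ₂ = 0 at hst
  have hy := congrArg (fun z => ∂y z) hst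
  simp only [map_add, Derivation.leibniz, smul_eq_mul, hs, ht, mul_zero, add_zero, map_zero] at hy
  have h1 : s * (ψ₂ * ∂y ψ₁ - ψ₁ * ∂y ψ₂) = 0 := by
    linear_combination ψ₂ * hy - ∂y ψ₂ * hst
  have h2 : t * (ψ₂ * ∂y ψ₁ - ψ₁ * ∂y ψ₂) = 0 := by
    linear_combination ∂y ψ₁ * hst - ψ₁ * hy
  exact ⟨Subtype.ext ((mul_eq_zero.mp h1).resolve_right h),
    Subtype.ext ((mul_eq_zero.mp h2).resolve_right h)⟩

/-- Cramer's rule: `(r, 1, q)` is orthogonal to both rows `(ψ_i, ψ_{i,x}, ψ_{i,y})`, hence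
proportional to their vector of cofactors, and the middle entry fixes the factor `d`. -/
theorem isNormalizedWronskian_opM {L : LPDO K} {q r ψ₁ ψ₂ : K} (hL₁ : applyOp L ψ₁ = 0)
    (hL₂ : applyOp L ψ₂ = 0) (hM₁ : ∂x ψ₁ + q * ∂y ψ₁ + r * ψ₁ = 0)
    (hM₂ : ∂x ψ₂ + q * ∂y ψ₂ + r * ψ₂ = 0) (hd : wronskianDet 0 1 0 ψ₁ ψ₂ ≠ 0) :
    IsNormalizedWronskian L (opM q r) := by
  refine ⟨ψ₁, ψ₂, hL₁, hL₂, linearIndependent_of_wronskianDet_ne_zero hd, hd, ?_⟩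
  have h0 : wronskianDet 1 0 0 ψ₁ ψ₂ = wronskianDet 0 1 0 ψ₁ ψ₂ * r := by
    simp [wronskianDet, Matrix.det_fin_three]
    linear_combination ∂y ψ₂ * hM₁ - ∂y ψ₁ * hM₂
  have h1 : wronskianDet 0 0 1 ψ₁ ψ₂ = wronskianDet 0 1 0 ψ₁ ψ₂ * q := by
    simp [wronskianDet, Matrix.det_fin_three]
    linear_combination ψ₁ * hM₂ - ψ₂ * hM₁
  rw [eq_inv_smul_iff₀ hd, wronskianOp, opM, h0, h1]
  simp only [smul_add, smul_single, smul_eq_mul, mul_one]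
  abel

end Operators

/-! ### Common solutions, descent and reduction to the normalized case -/

section Completeness

variable {K : Type u} [Field K] [PDiffField K]

local notation "∂x" => PDiffField.dx
local notation "∂y" => PDiffField.dy

/-- If `N ∘ L = L₁ ∘ M` then `L ψ = M ψ = 0` has, over some differential field extension, two
solutions for which the coefficient of `D_x` in the Wronskian operator does not vanish. -/
theorem exists_extension_solutions {a b c a₁ b₁ c₁ q r : K} {N : LPDO K} (hq : q ≠ 0)
    (hN : comp N (opL a b c) = comp (opL a₁ b₁ c₁) (opM q r)) :
    ∃ (F : Type u) (_ : Field F) (_ : PDiffField F) (_ : Algebra K F), IsDiffExtension K F ∧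
      ∃ ψ : Fin 2 → F,
        (∀ k, applyOp ((opL a b c).baseChange F) (ψ k) = 0 ∧
          ∂x (ψ k) + algebraMap K F q * ∂y (ψ k) + algebraMap K F r * ψ k = 0) ∧
        wronskianDet 0 1 0 (ψ 0) (ψ 1) ≠ 0 := by
  -- With `φ_y = g ψ + h φ`, these values come from differentiating `ψ_x = -r ψ - q φ` in `y`,
  -- equating with `φ_x` and dividing by `q`.
  obtain ⟨g, hg⟩ : ∃ g, q * g = -(∂y r + (a * r - c)) := ⟨_, mul_div_cancel₀ _ hq⟩
  obtain ⟨h, hh⟩ : ∃ h, q * h = -(∂y q + r + (a * q - b)) := ⟨_, mul_div_cancel₀ _ hq⟩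
  obtain ⟨h₁, h₂⟩ := integrability_of_comp_eq hq hN hg hh
  obtain ⟨F, iF, iD, iA, hF, u, hx, hy, hu⟩ := exists_fundamental_matrix
    ![![-r, -q], ![a * r - c, a * q - b]] ![![0, 1], ![g, h]] (by
      simp only [Fin.forall_fin_two, Fin.sum_univ_two, Matrix.cons_val_zero, Matrix.cons_val_one,
        map_neg, map_zero, Derivation.map_one_eq_zero]
      -- The first row of the integrability condition holds by the choice of `g` and `h`; the second
      -- row is what the Darboux relation supplies.
      refine ⟨⟨?_, ?_⟩, ?_, ?_⟩
      · linear_combination -hg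
      · linear_combination -hh
      · linear_combination h₁
      · linear_combination h₂)
  simp only [Fin.forall_fin_two, Fin.sum_univ_two, Matrix.cons_val_zero, Matrix.cons_val_one,
    map_neg, map_zero, map_one, map_sub, map_mul] at hx hy
  obtain ⟨⟨hx00, hx01⟩, hx10, hx11⟩ := hx
  obtain ⟨⟨hy00, hy01⟩, -, -⟩ := hy
  rw [zero_mul, zero_add, one_mul] at hy00 hy01
  refine ⟨F, iF, iD, iA, hF, u 0, ?_, ?_⟩
  · simp only [baseChange_opL, applyOp_opL, Fin.forall_fin_two, hy00, hy01, hx00, hx01, hx10, hx11]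
    refine ⟨⟨?_, ?_⟩, ?_, ?_⟩ <;> ring
  · rw [wronskianDet_zero_one_zero, hy00, hy01]
    intro h0
    exact hu (by linear_combination -h0)

/-- The differential polynomials `L u_k`, `M u_k` and the `D_x`-coefficient of the Wronskian
operator of `u_0, u_1` express the conditions on `ψ_1, ψ_2` as a differential system, so that its
solutions descend to a differentially closed field. -/
theorem IsDifferentiallyClosed.exists_solutions (hK : IsDifferentiallyClosed K)
    {a b c q r : K} {F : Type u} [Field F] [PDiffField F] [Algebra K F] (hF : IsDiffExtension K F)
    {ψ : Fin 2 → F}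
    (hψ : ∀ k, applyOp ((opL a b c).baseChange F) (ψ k) = 0 ∧
      ∂x (ψ k) + algebraMap K F q * ∂y (ψ k) + algebraMap K F r * ψ k = 0)
    (hd : wronskianDet 0 1 0 (ψ 0) (ψ 1) ≠ 0) :
    ∃ ψ : Fin 2 → K,
      (∀ k, applyOp (opL a b c) (ψ k) = 0 ∧ ∂x (ψ k) + q * ∂y (ψ k) + r * ψ k = 0) ∧
      wronskianDet 0 1 0 (ψ 0) (ψ 1) ≠ 0 := by
  classical
  let X : Fin 2 → ℕ → ℕ → DiffPoly 2 K := fun k i j => MvPolynomial.X (k, i, j)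
  let l : Fin 2 → DiffPoly 2 K := fun k => X k 1 1 + MvPolynomial.C a * X k 1 0 +
    MvPolynomial.C b * X k 0 1 + MvPolynomial.C c * X k 0 0
  let m : Fin 2 → DiffPoly 2 K := fun k => X k 1 0 + MvPolynomial.C q * X k 0 1 +
    MvPolynomial.C r * X k 0 0
  -- Linear independence over the constants need not be encoded: it follows from `d ≠ 0`.
  let w : DiffPoly 2 K := X 1 0 0 * X 0 0 1 - X 0 0 0 * X 1 0 1
  obtain ⟨u, hu, hw⟩ := hK F hF 2 (Finset.univ.image l ∪ Finset.univ.image m) w (by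
    refine ⟨ψ, fun p hp => ?_, ?_⟩
    · rcases Finset.mem_union.mp hp with hp | hp <;>
        obtain ⟨k, -, rfl⟩ := Finset.mem_image.mp hp
      · have h := (hψ k).1
        rw [baseChange_opL, applyOp_opL] at h
        simpa [DiffPoly.evalAt, l, X, pderiv] using h
      · simpa [DiffPoly.evalAt, m, X, pderiv] using (hψ k).2
    · rw [wronskianDet_zero_one_zero] at hd
      simpa [DiffPoly.evalAt, w, X, pderiv] using hd)
  refine ⟨u, fun k => ⟨?_, ?_⟩, ?_⟩
  · have h := hu (l k) (Finset.mem_union_left _ (Finset.mem_image_of_mem l (Finset.mem_univ k)))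
    rw [applyOp_opL]
    simpa [DiffPoly.evalAt, l, X, pderiv] using h
  · have h := hu (m k) (Finset.mem_union_right _ (Finset.mem_image_of_mem m (Finset.mem_univ k)))
    simpa [DiffPoly.evalAt, m, X, pderiv] using h
  · rw [wronskianDet_zero_one_zero]
    simpa [DiffPoly.evalAt, w, X, pderiv] using hw

theorem exists_extension_isNormalizedWronskian {a b c a₁ b₁ c₁ q r : K} {N : LPDO K} (hq : q ≠ 0)
    (hN : comp N (opL a b c) = comp (opL a₁ b₁ c₁) (opM q r)) :
    ∃ (F : Type u) (_ : Field F) (_ : PDiffField F) (_ : Algebra K F), IsDiffExtension K F ∧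
      IsNormalizedWronskian ((opL a b c).baseChange F) ((opM q r).baseChange F) := by
  obtain ⟨F, iF, iD, iA, hF, ψ, hψ, hd⟩ := exists_extension_solutions hq hN
  refine ⟨F, iF, iD, iA, hF, ?_⟩
  rw [baseChange_opM]
  exact isNormalizedWronskian_opM (hψ 0).1 (hψ 1).1 (hψ 0).2 (hψ 1).2 hd

theorem IsDifferentiallyClosed.isNormalizedWronskian (hK : IsDifferentiallyClosed K)
    {a b c a₁ b₁ c₁ q r : K} {N : LPDO K} (hq : q ≠ 0)
    (hN : comp N (opL a b c) = comp (opL a₁ b₁ c₁) (opM q r)) :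
    IsNormalizedWronskian (opL a b c) (opM q r) := by
  obtain ⟨F, iF, iD, iA, hF, ψ, hψ, hd⟩ := exists_extension_solutions hq hN
  obtain ⟨u, hu, hd'⟩ := hK.exists_solutions hF hψ hd
  exact isNormalizedWronskian_opM (hu 0).1 (hu 1).1 (hu 0).2 (hu 1).2 hd'

/-- An operator of bi-degree `(1, 1)` reduces to a normalized first order one modulo left multiples
of `L`, and the reduction preserves the property of generating a Darboux transformation. -/
theorem HasBidegree.exists_reduction {a b c : K} {M N L₁ : LPDO K}
    (hM : HasBidegree (opL a b c) M 1 1) (hD : IsDarboux (opL a b c) M N L₁) :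
    ∃ (p q r : K) (A N' : LPDO K) (a' b' c' : K), p ≠ 0 ∧ q ≠ 0 ∧
      M = p • opM q r + comp A (opL a b c) ∧
      comp N' (opL a b c) = comp (opL a' b' c') (opM q r) := by
  obtain ⟨M', A, rfl, hmix, hx, hy⟩ := hM
  obtain ⟨p, q, r, hp, hq, rfl⟩ := exists_eq_smul_opM hmix hx hy
  obtain ⟨hsym, hcomp⟩ := hD
  obtain ⟨a₁, b₁, c₁, rfl⟩ := exists_eq_opL_of_symbol_eq hsym
  obtain ⟨a', b', c', h'⟩ := comp_opL_single a₁ b₁ c₁ hp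
  -- With `M = p M₀ + A ∘ L`, the relation becomes `(N - L₁ ∘ A) ∘ L = L₁ ∘ p ∘ M₀ = p L' ∘ M₀`,
  -- where `L'` is the gauge transform of `L₁`; dividing by `p` gives the new left factor.
  refine ⟨p, q, r, A, p⁻¹ • (N + (-1 : K) • comp (opL a₁ b₁ c₁) A), a', b', c', hp, hq, rfl, ?_⟩
  rw [comp_smul_left, comp_add_left, comp_smul_left, hcomp, comp_assoc, comp_add_right,
    ← comp_single_zero_left p, ← comp_assoc, h', comp_smul_left, neg_one_smul,
    add_neg_cancel_right, inv_smul_smul₀ hp]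

end Completeness

end DarbouxWronskian

open DarbouxWronskian
theorem mainTheorem1 {K : Type u} [Field K] [CharZero K] [PDiffField K] (a b c : K) :
    (IsDifferentiallyClosed K →
      (∀ (q r : K) (N L₁ : LPDO K), q ≠ 0 → IsDarboux (opL a b c) (opM q r) N L₁ →
        IsNormalizedWronskian (opL a b c) (opM q r)) ∧
      (∀ M N L₁ : LPDO K, HasBidegree (opL a b c) M 1 1 → IsDarboux (opL a b c) M N L₁ →
        IsWronskianModulo (opL a b c) M)) ∧
    (∀ (q r : K) (N L₁ : LPDO K), q ≠ 0 → IsDarboux (opL a b c) (opM q r) N L₁ →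
      ∃ (F : Type u) (_ : Field F) (_ : PDiffField F) (_ : Algebra K F), IsDiffExtension K F ∧
        IsNormalizedWronskian ((opL a b c).baseChange F) ((opM q r).baseChange F)) ∧
    (∀ M N L₁ : LPDO K, HasBidegree (opL a b c) M 1 1 → IsDarboux (opL a b c) M N L₁ →
      ∃ (F : Type u) (_ : Field F) (_ : PDiffField F) (_ : Algebra K F), IsDiffExtension K F ∧
        IsWronskianModulo ((opL a b c).baseChange F) (M.baseChange F)) := by
  refine ⟨fun hK => ⟨?_, ?_⟩, ?_, ?_⟩
  · rintro q r N L₁ hq ⟨hsym, hcomp⟩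
    obtain ⟨a₁, b₁, c₁, rfl⟩ := exists_eq_opL_of_symbol_eq hsym
    exact hK.isNormalizedWronskian hq hcomp
  · intro M N L₁ hM hD
    obtain ⟨p, q, r, A, N', a', b', c', hp, hq, rfl, hN'⟩ := hM.exists_reduction hD
    exact ⟨p, A, opM q r, hp, hK.isNormalizedWronskian hq hN', rfl⟩
  · rintro q r N L₁ hq ⟨hsym, hcomp⟩
    obtain ⟨a₁, b₁, c₁, rfl⟩ := exists_eq_opL_of_symbol_eq hsym
    exact exists_extension_isNormalizedWronskian hq hcomp
  · intro M N L₁ hM hD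
    obtain ⟨p, q, r, A, N', a', b', c', hp, hq, rfl, hN'⟩ := hM.exists_reduction hD
    obtain ⟨F, iF, iD, iA, hF, hW⟩ := exists_extension_isNormalizedWronskian hq hN'
    -- The factor `p` and the operator `A` already live over `K`; only the solutions `ψ₁, ψ₂`
    -- require the extension.
    refine ⟨F, iF, iD, iA, hF, algebraMap K F p, A.baseChange F, (opM q r).baseChange F,
      (map_ne_zero _).mpr hp, hW, ?_⟩
    rw [baseChange_add, baseChange_smul, baseChange_comp hF]
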